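/- Let $\mathcal{A}$ be a finite set of $n$ linear hyperplanes in $\mathbb{R}^d$ (a real central hyperplane arrangement), and let $r=\operatorname{codim}\bigcap_{H\in\mathcal{A}}H$ be its rank. For chambers $C,C'$ of $\mathcal{A}$ (connected components of $\mathbb{R}^d\setminus\bigcup_{H\in\mathcal{A}}H$) let $S(C,C')\subseteq\mathcal{A}$ be the set of hyperplanes separating $C$ from $C'$. The tope graph $\mathcal{T}(\mathcal{A})$ has the chambers as vertices, with $C,C'$ adjacent if and only if $\#S(C,C')=1$; let $\operatorname{dist}$ be its shortest-path distance. For $k,\ell\ge 0$ let $MC_{k,\ell}(\mathcal{A})$ be the free abelian group on the tuples $x=(x_0,\dots,x_k)$ of chambers with $x_{i}\ne x_{i+1}$ for all $i$ and $\sum_{i=0}^{k-1}\operatorname{dist}(x_i,x_{i+1})=\ell$, and let $\partial=\sum_{i=1}^{k-1}(-1)^{i-1}\partial_i: MC_{k,\ell}(\mathcal{A})\to MC_{k-1,\ell}(\mathcal{A})$, where $\partial_i x$ is $x$ with $x_i$ deleted if $\operatorname{dist}(x_{i-1},x_{i+1})=\operatorname{dist}(x_{i-1},x_i)+\operatorname{dist}(x_i,x_{i+1})$,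 and $\partial_i x=0$ otherwise. Put $S(x)=S(x_0,x_1)\cup\dots\cup S(x_{k-1},x_k)$. The interior magnitude complex $MC^{\circ}_{*,\ell}(\mathcal{A})$ is the subcomplex $\bigoplus_{\mathcal{B}}MC_{*,\ell}(\mathcal{A};\mathcal{B})$, where $\mathcal{B}$ runs over the subsets of $\mathcal{A}$ with $\bigcap_{H\in\mathcal{B}}H=\bigcap_{H\in\mathcal{A}}H$ and $MC_{k,\ell}(\mathcal{A};\mathcal{B})$ is the subgroup generated by the tuples $x$ with $S(x)=\mathcal{B}$ (the intersection over $\mathcal{B}=\varnothing$ is $\mathbb{R}^d$). Its homology $MH^{\circ}_{k,\ell}(\mathcal{A})$ is the interior magnitude homology of $\mathcal{A}$. Theorem. Suppose that $\mathcal{A}$ is not Boolean, i.e. there is no linear coordinate system of $\mathbb{R}^d$ in which every member of $\mathcal{A}$ is a coordinate hyperplane. Then $r<n$, and the diagonal interior magnitude homology of $\mathcal{A}$ vanishes in all lengths: \[ MH^{\circ}_{\ell,\ell}(\mathcal{A})=0\qquad\text{for all }\ell\ge 0 . \] -/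

import Mathlib

noncomputable section

namespace GraphMagnitude

variable {V : Type*}

/-- The length `d(x₀,x₁) + ⋯ + d(x_{k-1},x_k)` of a `k`-chain `(x₀, …, x_k)` of vertices, where `d`
is the shortest-path distance of the graph (`⊤` if there is no walk). -/
def chainLength (G : SimpleGraph V) {k : ℕ} (x : Fin (k + 1) → V) : ℕ∞ :=
  ∑ i : Fin k, G.edist (x i.castSucc) (x i.succ)

/-- The set `P_{k,ℓ}(G)` of proper `k`-chains of length `ℓ`. -/
def ProperChain (G : SimpleGraph V) (k ℓ : ℕ) : Type _ :=
  {x : Fin (k + 1) → V //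
    (∀ i : Fin k, x i.castSucc ≠ x i.succ) ∧ chainLength G x = (ℓ : ℕ∞)}

/-- The magnitude chain group `MC_{k,ℓ}(G)`, free abelian on `P_{k,ℓ}(G)`. -/
abbrev MC (G : SimpleGraph V) (k ℓ : ℕ) : Type _ := ProperChain G k ℓ →₀ ℤ

/-- The interior vertex `x_{i+1}` (`0 ≤ i < k`) of a `(k+1)`-chain is smooth:
`d(x_i, x_{i+2}) = d(x_i, x_{i+1}) + d(x_{i+1}, x_{i+2})`. -/
def IsSmooth (G : SimpleGraph V) {k : ℕ} (x : Fin (k + 2) → V) (i : Fin k) : Prop :=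
  G.edist (x i.castSucc.castSucc) (x i.succ.succ) =
    G.edist (x i.castSucc.castSucc) (x i.succ.castSucc) +
      G.edist (x i.succ.castSucc) (x i.succ.succ)

/-- Deletion of the interior vertex `x_{i+1}` from a `(k+1)`-chain. -/
def deleteVertex {k : ℕ} (x : Fin (k + 2) → V) (i : Fin k) : Fin (k + 1) → V :=
  fun j => x (i.succ.castSucc.succAbove j)

theorem deleteVertex_step_of_ne {k : ℕ} (x : Fin (k + 2) → V) {i j : Fin k} (h : j ≠ i) :
    deleteVertex x i j.castSucc = x (i.castSucc.succAbove j).castSucc ∧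
      deleteVertex x i j.succ = x (i.castSucc.succAbove j).succ := by
  have h' : (j : ℕ) ≠ i := fun e => h (Fin.ext e)
  unfold deleteVertex
  constructor <;> congr 1 <;> apply Fin.ext <;>
    simp only [Fin.succAbove, Fin.lt_def, Fin.val_castSucc, Fin.val_succ] <;>
    split_ifs <;> simp only [Fin.val_castSucc, Fin.val_succ] <;> omega

theorem deleteVertex_step_self {k : ℕ} (x : Fin (k + 2) → V) (i : Fin k) :
    deleteVertex x i i.castSucc = x i.castSucc.castSucc ∧
      deleteVertex x i i.succ = x i.succ.succ := by
  unfold deleteVertex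
  constructor <;> congr 1 <;> apply Fin.ext <;>
    simp [Fin.succAbove, Fin.lt_def]

/-- Deleting a smooth vertex from a proper chain gives a proper chain of the same length. -/
theorem deleteVertex_mem (G : SimpleGraph V) {k ℓ : ℕ} (x : ProperChain G (k + 1) ℓ) (i : Fin k)
    (h : IsSmooth G x.1 i) :
    (∀ j : Fin k, deleteVertex x.1 i j.castSucc ≠ deleteVertex x.1 i j.succ) ∧
      chainLength G (deleteVertex x.1 i) = (ℓ : ℕ∞) := by
  obtain ⟨x, hx, hl⟩ := x
  simp only at h ⊢
  constructor
  · intro j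
    by_cases hj : j = i
    · subst hj
      rw [(deleteVertex_step_self x j).1, (deleteVertex_step_self x j).2]
      intro e
      have h0 := h
      unfold IsSmooth at h0
      rw [e, SimpleGraph.edist_self] at h0
      have h1 := (add_eq_zero.mp h0.symm).2
      rw [SimpleGraph.edist_eq_zero_iff] at h1
      exact hx j.succ h1
    · rw [(deleteVertex_step_of_ne x hj).1, (deleteVertex_step_of_ne x hj).2]
      exact hx _
  · rw [← hl]
    unfold chainLength
    rw [Fin.sum_univ_succAbove _ i.castSucc, ← Finset.add_sum_erase _ _ (Finset.mem_univ i),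
      ← Finset.add_sum_erase _
        (fun j : Fin k => G.edist (x (i.castSucc.succAbove j).castSucc)
          (x (i.castSucc.succAbove j).succ)) (Finset.mem_univ i), ← add_assoc]
    congr 1
    · rw [(deleteVertex_step_self x i).1, (deleteVertex_step_self x i).2, h]
      simp
    · refine Finset.sum_congr rfl fun j hj => ?_
      have hj' := Finset.ne_of_mem_erase hj
      rw [(deleteVertex_step_of_ne x hj').1, (deleteVertex_step_of_ne x hj').2]

open Classical in
/-- `∂_{i+1}` on a generator: delete `x_{i+1}` if it is smooth, and give `0` otherwise. -/
def face (G : SimpleGraph V) {k ℓ : ℕ} (i : Fin k) (x : ProperChain G (k + 1) ℓ) : MC G k ℓ :=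
  if h : IsSmooth G x.1 i then Finsupp.single ⟨deleteVertex x.1 i, deleteVertex_mem G x i h⟩ 1
  else 0

/-- The boundary operator `∂ = ∑_{i=1}^{k} (-1)^{i-1} ∂_i : MC_{k+1,ℓ}(G) → MC_{k,ℓ}(G)`
(the summation index below is `i - 1`). -/
def boundary (G : SimpleGraph V) (k ℓ : ℕ) : MC G (k + 1) ℓ →ₗ[ℤ] MC G k ℓ :=
  Finsupp.lsum ℤ fun x => LinearMap.toSpanSingleton ℤ (MC G k ℓ)
    (∑ i : Fin k, (-1 : ℤ) ^ (i : ℕ) • face G i x)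

/-- The cycles in `MC_{k,ℓ}(G)` (every `0`-chain is a cycle). -/
def cycles (G : SimpleGraph V) (ℓ : ℕ) : (k : ℕ) → Submodule ℤ (MC G k ℓ)
  | 0 => ⊤
  | k + 1 => LinearMap.ker (boundary G k ℓ)

/-- The degree `k` homology of a subcomplex `M_*` of `MC_{*,ℓ}(G)`:
`{c ∈ M_k | ∂ c = 0} / ∂ M_{k+1}`. -/
abbrev subcomplexHomology (G : SimpleGraph V) (ℓ : ℕ) (M : (k : ℕ) → Submodule ℤ (MC G k ℓ))
    (k : ℕ) : Type _ :=
  ↥(M k ⊓ cycles G ℓ k) ⧸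
    ((M (k + 1)).map (boundary G k ℓ)).submoduleOf (M k ⊓ cycles G ℓ k)

end GraphMagnitude

/-- A real central hyperplane arrangement in `ℝ^d`: a finite set of linear hyperplanes. -/
structure Arrangement (d : ℕ) where
  hyperplanes : Finset (Submodule ℝ (EuclideanSpace ℝ (Fin d)))
  codim_one : ∀ H ∈ hyperplanes, Module.finrank ℝ (EuclideanSpace ℝ (Fin d) ⧸ H) = 1

namespace Arrangement

variable {d : ℕ}

/-- The intersection `∩𝓑` of a set of hyperplanes (the whole space if the set is empty). -/
def inter (B : Set (Submodule ℝ (EuclideanSpace ℝ (Fin d)))) :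
    Submodule ℝ (EuclideanSpace ℝ (Fin d)) := sInf B

/-- The center `∩𝓐`. -/
def center (A : Arrangement d) : Submodule ℝ (EuclideanSpace ℝ (Fin d)) :=
  inter (A.hyperplanes : Set (Submodule ℝ (EuclideanSpace ℝ (Fin d))))

/-- The rank of `𝓐`: the codimension of its center. -/
def rank (A : Arrangement d) : ℕ := Module.finrank ℝ (EuclideanSpace ℝ (Fin d) ⧸ A.center)

/-- The number `#𝓐` of hyperplanes. -/
def card (A : Arrangement d) : ℕ := A.hyperplanes.card

/-- `𝓐` is Boolean: in suitable linear coordinates of `ℝ^d` all its members are coordinate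
hyperplanes (so that, up to essentialization, it is the arrangement of the `r` coordinate
hyperplanes of `ℝ^r`). -/
def IsBoolean (A : Arrangement d) : Prop :=
  ∃ b : Module.Basis (Fin d) ℝ (EuclideanSpace ℝ (Fin d)),
    ∀ H ∈ A.hyperplanes, ∃ i : Fin d, H = LinearMap.ker (b.coord i)

/-- The complement of the union of the hyperplanes. -/
def complement (A : Arrangement d) : Set (EuclideanSpace ℝ (Fin d)) :=
  {x | ∀ H ∈ A.hyperplanes, x ∉ H}

/-- The set `Ch(𝓐)` of chambers: the connected components of the complement. -/
def Chamber (A : Arrangement d) : Type :=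
  {C : Set (EuclideanSpace ℝ (Fin d)) //
    ∃ x ∈ A.complement, C = connectedComponentIn A.complement x}

/-- The hyperplane `H` separates the sets `C` and `C'`: they lie in opposite open half-spaces
bounded by `H`. -/
def Separates (H : Submodule ℝ (EuclideanSpace ℝ (Fin d)))
    (C C' : Set (EuclideanSpace ℝ (Fin d))) : Prop :=
  ∃ α : EuclideanSpace ℝ (Fin d) →ₗ[ℝ] ℝ, LinearMap.ker α = H ∧
    (∀ x ∈ C, 0 < α x) ∧ (∀ y ∈ C', α y < 0)

/-- The set `S(C, C')` of the hyperplanes of `𝓐` that separate the chambers `C` and `C'`. -/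
def sep (A : Arrangement d) (C C' : A.Chamber) :
    Set (Submodule ℝ (EuclideanSpace ℝ (Fin d))) :=
  {H | H ∈ A.hyperplanes ∧ Separates H C.1 C'.1}

theorem separates_symm {H : Submodule ℝ (EuclideanSpace ℝ (Fin d))}
    {C C' : Set (EuclideanSpace ℝ (Fin d))} (h : Separates H C C') : Separates H C' C := by
  obtain ⟨α, hα, hC, hC'⟩ := h
  refine ⟨-α, ?_, fun x hx => by simpa using hC' x hx, fun x hx => by simpa using hC x hx⟩
  rw [← hα]
  ext x
  simp

theorem sep_comm (A : Arrangement d) (C C' : A.Chamber) : A.sep C C' = A.sep C' C :=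
  Set.ext fun _ => ⟨fun h => ⟨h.1, separates_symm h.2⟩, fun h => ⟨h.1, separates_symm h.2⟩⟩

theorem sep_self (A : Arrangement d) (C : A.Chamber) : A.sep C C = ∅ := by
  obtain ⟨C, x, hx, rfl⟩ := C
  refine Set.eq_empty_iff_forall_notMem.mpr ?_
  rintro H ⟨-, α, -, h1, h2⟩
  have hm := mem_connectedComponentIn hx
  exact lt_asymm (h1 x hm) (h2 x hm)

/-- The tope graph `𝓣(𝓐)`: two chambers are adjacent if exactly one hyperplane of `𝓐`
separates them. -/
def topeGraph (A : Arrangement d) : SimpleGraph A.Chamber where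
  Adj C C' := ∃ H, A.sep C C' = {H}
  symm := ⟨fun C C' ⟨H, h⟩ => ⟨H, by rw [A.sep_comm]; exact h⟩⟩
  loopless := ⟨fun C ⟨H, h⟩ => by
    rw [A.sep_self] at h
    exact (Set.singleton_ne_empty H) h.symm⟩

/-- The set `S(x) = S(x₀,x₁) ∪ ⋯ ∪ S(x_{k-1},x_k)` of the hyperplanes crossed by a chain. -/
def crossed (A : Arrangement d) {k : ℕ} (x : Fin (k + 1) → A.Chamber) :
    Set (Submodule ℝ (EuclideanSpace ℝ (Fin d))) :=
  ⋃ i : Fin k, A.sep (x i.castSucc) (x i.succ)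

/-- The `𝓑`-supported magnitude chain group `MC_{k,ℓ}(𝓐; 𝓑)`: the subgroup of
`MC_{k,ℓ}(𝓣(𝓐))` generated by the chains `x` with `S(x) = 𝓑`. -/
def suppMC (A : Arrangement d) (k ℓ : ℕ)
    (B : Set (Submodule ℝ (EuclideanSpace ℝ (Fin d)))) :
    Submodule ℤ (GraphMagnitude.MC A.topeGraph k ℓ) :=
  Submodule.span ℤ {c | ∃ x : GraphMagnitude.ProperChain A.topeGraph k ℓ,
    A.crossed x.1 = B ∧ c = Finsupp.single x 1}

/-- The `X`-supported magnitude chain group `MC_{k,ℓ}(𝓐; X) = ⨁_{𝓑 ⊆ 𝓐, ∩𝓑 = X} MC_{k,ℓ}(𝓐; 𝓑)`,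
as an internal sum in `MC_{k,ℓ}(𝓣(𝓐))`. -/
def flatMC (A : Arrangement d) (k ℓ : ℕ) (X : Submodule ℝ (EuclideanSpace ℝ (Fin d))) :
    Submodule ℤ (GraphMagnitude.MC A.topeGraph k ℓ) :=
  ⨆ B ∈ {B : Set (Submodule ℝ (EuclideanSpace ℝ (Fin d))) |
      B ⊆ (A.hyperplanes : Set (Submodule ℝ (EuclideanSpace ℝ (Fin d)))) ∧ inter B = X},
    A.suppMC k ℓ B

/-- The interior magnitude chain group `MC°_{k,ℓ}(𝓐) = MC_{k,ℓ}(𝓐; ∩𝓐)`. -/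
def interiorMC (A : Arrangement d) (k ℓ : ℕ) :
    Submodule ℤ (GraphMagnitude.MC A.topeGraph k ℓ) :=
  A.flatMC k ℓ A.center

/-- The interior magnitude homology `MH°_{k,ℓ}(𝓐)`. -/
abbrev interiorMH (A : Arrangement d) (k ℓ : ℕ) : Type _ :=
  GraphMagnitude.subcomplexHomology A.topeGraph ℓ (fun j => A.interiorMC j ℓ) k

end Arrangement

end

/-! The group of diagonal interior cycles is already zero. A proper chain whose degree equals its
length is a walk in the tope graph, hence is determined by its first chamber C and the word of
hyperplanes it crosses. Where two consecutive letters H ≠ K occur, the middle chamber is smooth. In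
a cycle the resulting face must cancel, which needs a second walk in the support with another
midpoint, and that walk crosses K before H (`HasWord.exists_swap`). So the words in the support with
start C are closed under adjacent swaps, hence under all permutations.

Let B be the set of letters of one such word. Given T ⊆ B, some permutation lists T first, each
element once; the chamber D reached after this prefix has S(C,D) = T. Thus every sign pattern on B
is realised by a chamber separated from C by hyperplanes of B only. If the chain is interior, the
normals of B span those of all of 𝓐. Choosing signs against the coefficients of a linear combination
shows that B = 𝓐 and that the normals are independent (`isBoolean_of_forall_exists_sep`), so 𝓐 is
Boolean. The inequality r < n holds because r is the dimension of the span of the n normals. -/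

noncomputable section

/-! ### Walks and cancellation in diagonal cycles -/

namespace GraphMagnitude

variable {V : Type*}

/-- A proper chain whose degree equals its length is a walk: all its steps are edges. -/
theorem ProperChain.adj_of_degree_eq_length {G : SimpleGraph V} {l : ℕ} (x : ProperChain G l l)
    (i : Fin l) : G.Adj (x.1 i.castSucc) (x.1 i.succ) := by
  obtain ⟨x, hx, hl⟩ := x
  simp only
  have h1 : ∀ j : Fin l, 1 ≤ G.edist (x j.castSucc) (x j.succ) := fun j => by
    rw [Order.one_le_iff_ne_zero, Ne, SimpleGraph.edist_eq_zero_iff]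
    exact hx j
  rw [← SimpleGraph.edist_eq_one_iff_adj]
  by_contra hne
  have h2 : (2 : ℕ∞) ≤ G.edist (x i.castSucc) (x i.succ) := by
    have := Order.add_one_le_of_lt (lt_of_le_of_ne (h1 i) (Ne.symm hne))
    rwa [one_add_one_eq_two] at this
  -- All l steps have length at least 1, so a single step of length 2 makes the total exceed l.
  have h3 : ((l + 1 : ℕ) : ℕ∞) ≤ chainLength G x := by
    calc ((l + 1 : ℕ) : ℕ∞) = ∑ j : Fin l, (1 + if j = i then 1 else 0) := by
          rw [Finset.sum_add_distrib]; simp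
      _ ≤ _ := by
          refine Finset.sum_le_sum fun j _ => ?_
          split_ifs with h
          · subst h; rwa [one_add_one_eq_two]
          · simpa using h1 j
  rw [hl, Nat.cast_le] at h3
  omega

/-- Two walks with a common smooth face have that face at the same place. -/
theorem eq_of_deleteVertex_eq {G : SimpleGraph V} {l : ℕ} {x y : ProperChain G (l + 1) (l + 1)}
    {i j : Fin l} (hx : IsSmooth G x.1 i) (h : deleteVertex y.1 j = deleteVertex x.1 i) :
    j = i := by
  by_contra hne
  have h1 := deleteVertex_step_self x.1 i
  have h2 := deleteVertex_step_of_ne y.1 (Ne.symm hne)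
  -- Deletion leaves a step of length 2 at the place of the deleted vertex and edges elsewhere; for
  -- j ≠ i the step at i would still be an edge of y.
  have h3 : G.edist (deleteVertex x.1 i i.castSucc) (deleteVertex x.1 i i.succ) = 1 := by
    rw [← h, h2.1, h2.2, SimpleGraph.edist_eq_one_iff_adj]
    exact y.adj_of_degree_eq_length _
  have h4 := SimpleGraph.edist_eq_one_iff_adj.mpr (x.adj_of_degree_eq_length i.castSucc)
  have h5 := SimpleGraph.edist_eq_one_iff_adj.mpr (x.adj_of_degree_eq_length i.succ)
  rw [Fin.succ_castSucc] at h4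
  rw [h1.1, h1.2, hx, h4, h5] at h3
  exact absurd h3 (by decide)

theorem face_apply_eq_one {G : SimpleGraph V} {k l : ℕ} {i : Fin k} {x : ProperChain G (k + 1) l}
    {z : ProperChain G k l} (h : IsSmooth G x.1 i) (hz : z.1 = deleteVertex x.1 i) :
    face G i x z = 1 := by
  obtain rfl : z = (⟨deleteVertex x.1 i, deleteVertex_mem G x i h⟩ : ProperChain G k l) :=
    Subtype.ext hz
  unfold face
  rw [dif_pos h]
  exact Finsupp.single_eq_same

theorem face_apply_eq_zero {G : SimpleGraph V} {k l : ℕ} {i : Fin k}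
    {x : ProperChain G (k + 1) l} {z : ProperChain G k l} (hz : z.1 ≠ deleteVertex x.1 i) :
    face G i x z = 0 := by
  unfold face
  split_ifs with h
  · exact Finsupp.single_eq_of_ne fun e => hz (congrArg Subtype.val e)
  · rfl

theorem boundary_apply {G : SimpleGraph V} {k l : ℕ} (c : MC G (k + 1) l)
    (z : ProperChain G k l) :
    boundary G k l c z = ∑ x ∈ c.support, c x * ∑ i : Fin k, (-1 : ℤ) ^ (i : ℕ) * face G i x z := by
  rw [boundary, Finsupp.lsum_apply, Finsupp.sum, Finsupp.finsetSum_apply]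
  refine Finset.sum_congr rfl fun x _ => ?_
  rw [LinearMap.toSpanSingleton_apply, Finsupp.smul_apply, Finsupp.finsetSum_apply]
  rfl

/-- If a cycle of walks contains a walk with a smooth vertex, then it contains another walk which
differs only in that vertex. -/
theorem exists_ne_of_mem_ker_boundary {G : SimpleGraph V} {l : ℕ} {c : MC G (l + 1) (l + 1)}
    (hc : boundary G l (l + 1) c = 0) {x : ProperChain G (l + 1) (l + 1)} (hx : c x ≠ 0)
    {i : Fin l} (hi : IsSmooth G x.1 i) :
    ∃ y : ProperChain G (l + 1) (l + 1), y ≠ x ∧ c y ≠ 0 ∧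
      ∀ m, m ≠ i.succ.castSucc → y.1 m = x.1 m := by
  by_contra! hcon
  obtain ⟨z, hz⟩ : ∃ z : ProperChain G l (l + 1), z.1 = deleteVertex x.1 i :=
    ⟨⟨deleteVertex x.1 i, deleteVertex_mem G x i hi⟩, rfl⟩
  -- Without a second walk, only x at place i contributes to the coefficient of z, which is then ± c
  -- x ≠ 0.
  have hface : ∀ y : ProperChain G (l + 1) (l + 1), c y ≠ 0 → ∀ j : Fin l,
      (y ≠ x ∨ j ≠ i) → face G j y z = 0 := by
    intro y hy j h
    refine face_apply_eq_zero fun he => ?_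
    rw [hz] at he
    obtain rfl := eq_of_deleteVertex_eq hi he.symm
    obtain ⟨m, hm, hm'⟩ := hcon y (h.resolve_right (by simp)) hy
    obtain ⟨n, rfl⟩ := Fin.exists_succAbove_eq hm
    exact hm' (congrFun he.symm n)
  have h0 : boundary G l (l + 1) c z = 0 := by rw [hc]; rfl
  rw [boundary_apply, Finset.sum_eq_single x, Finset.sum_eq_single i,
    face_apply_eq_one hi hz] at h0
  · simp [hx] at h0
  · intro j _ hj
    rw [hface x hx j (Or.inr hj), mul_zero]
  · simp
  · intro y hy hyx
    rw [Finset.sum_eq_zero, mul_zero]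
    intro j _
    rw [hface y (Finsupp.mem_support_iff.mp hy) j (Or.inl hyx), mul_zero]
  · intro h
    exact absurd (Finsupp.mem_support_iff.mpr hx) h

end GraphMagnitude

/-- A set of lists of the same letters that is closed under adjacent swaps is closed under
permutations. -/
theorem List.Perm.of_adjacent_swap {α : Type*} {W : List α → Prop}
    (hW : ∀ l₁ a b l₂, W (l₁ ++ a :: b :: l₂) → W (l₁ ++ b :: a :: l₂)) {l l' : List α}
    (h : l.Perm l') : ∀ pre, W (pre ++ l) → W (pre ++ l') := by
  induction h with
  | nil => exact fun _ h => h
  | cons a _ ih =>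
    intro pre hp
    have := ih (pre ++ [a]) (by simpa using hp)
    simpa using this
  | swap a b l => exact fun pre hp => hW _ _ _ _ hp
  | trans _ _ ih1 ih2 => exact fun pre hp => ih2 pre (ih1 pre hp)

/-! ### Chambers and signs of normals -/

namespace Arrangement

variable {d : ℕ}

theorem exists_ker_eq (A : Arrangement d) {H : Submodule ℝ (EuclideanSpace ℝ (Fin d))}
    (hH : H ∈ A.hyperplanes) : ∃ α : EuclideanSpace ℝ (Fin d) →ₗ[ℝ] ℝ, LinearMap.ker α = H := by
  have h := A.codim_one H hH
  obtain ⟨e⟩ := FiniteDimensional.nonempty_linearEquiv_of_finrank_eq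
    (h.trans (Module.finrank_self ℝ).symm)
  exact ⟨e.toLinearMap ∘ₗ H.mkQ, by rw [LinearEquiv.ker_comp, Submodule.ker_mkQ]⟩

open Classical in
/-- A chosen linear form defining the hyperplane `H` of the arrangement. -/
def normal (A : Arrangement d) (H : Submodule ℝ (EuclideanSpace ℝ (Fin d))) :
    EuclideanSpace ℝ (Fin d) →ₗ[ℝ] ℝ :=
  if h : H ∈ A.hyperplanes then (A.exists_ker_eq h).choose else 0

theorem ker_normal (A : Arrangement d) {H : Submodule ℝ (EuclideanSpace ℝ (Fin d))}
    (hH : H ∈ A.hyperplanes) : LinearMap.ker (A.normal H) = H := by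
  rw [normal, dif_pos hH]
  exact (A.exists_ker_eq hH).choose_spec

/-- A point of a chamber. -/
def basePoint (A : Arrangement d) (C : A.Chamber) : EuclideanSpace ℝ (Fin d) := C.2.choose

theorem basePoint_mem_complement (A : Arrangement d) (C : A.Chamber) :
    A.basePoint C ∈ A.complement := C.2.choose_spec.1

theorem Chamber.eq_component {A : Arrangement d} (C : A.Chamber) :
    C.1 = connectedComponentIn A.complement (A.basePoint C) := C.2.choose_spec.2

theorem basePoint_mem (A : Arrangement d) (C : A.Chamber) : A.basePoint C ∈ C.1 := by
  rw [C.eq_component]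
  exact mem_connectedComponentIn (A.basePoint_mem_complement C)

theorem normal_ne_zero (A : Arrangement d) {H : Submodule ℝ (EuclideanSpace ℝ (Fin d))}
    (hH : H ∈ A.hyperplanes) {p : EuclideanSpace ℝ (Fin d)} (hp : p ∈ A.complement) :
    A.normal H p ≠ 0 := by
  intro h
  refine hp H hH ?_
  rw [← A.ker_normal hH]
  exact h

/-- A chamber is connected and avoids H, so the intermediate value theorem excludes a sign change.
-/
theorem normal_pos_iff (A : Arrangement d) {H : Submodule ℝ (EuclideanSpace ℝ (Fin d))}
    (hH : H ∈ A.hyperplanes) (C : A.Chamber) {p : EuclideanSpace ℝ (Fin d)} (hp : p ∈ C.1) :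
    0 < A.normal H p ↔ 0 < A.normal H (A.basePoint C) := by
  have hpre : IsPreconnected C.1 := by
    rw [C.eq_component]; exact isPreconnected_connectedComponentIn
  have hsub : C.1 ⊆ A.complement := by
    rw [C.eq_component]; exact connectedComponentIn_subset _ _
  have hcont : ContinuousOn (A.normal H) C.1 :=
    (LinearMap.continuous_of_finiteDimensional _).continuousOn
  have key : ∀ p ∈ C.1, ∀ q ∈ C.1, 0 < A.normal H p → 0 < A.normal H q := by
    intro p hp q hq h
    by_contra hn
    obtain ⟨z, hz, hz0⟩ := hpre.intermediate_value hq hp hcont ⟨not_lt.mp hn, h.le⟩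
    exact A.normal_ne_zero hH (hsub hz) hz0
  exact ⟨key _ hp _ (A.basePoint_mem C), key _ (A.basePoint_mem C) _ hp⟩

/-- Every form with kernel H is a multiple of the chosen normal, and the normal has constant sign on
a chamber; so separation is read off at base points. -/
theorem mem_sep_iff (A : Arrangement d) {H : Submodule ℝ (EuclideanSpace ℝ (Fin d))}
    {C C' : A.Chamber} : H ∈ A.sep C C' ↔ H ∈ A.hyperplanes ∧
      ¬ (0 < A.normal H (A.basePoint C) ↔ 0 < A.normal H (A.basePoint C')) := by
  refine and_congr_right fun hH => ?_
  have hC := A.normal_ne_zero hH (A.basePoint_mem_complement C)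
  have hC' := A.normal_ne_zero hH (A.basePoint_mem_complement C')
  constructor
  · rintro ⟨α, hα, h1, h2⟩ h
    have hmem := mem_span_of_iInf_ker_le_ker (L := fun _ : Unit => A.normal H) (K := α)
      (by rw [hα, A.ker_normal hH, iInf_const])
    rw [Set.range_const, Submodule.mem_span_singleton] at hmem
    obtain ⟨a, rfl⟩ := hmem
    have h1 := h1 _ (A.basePoint_mem C)
    have h2 := h2 _ (A.basePoint_mem C')
    simp only [LinearMap.smul_apply, smul_eq_mul] at h1 h2
    by_cases hp : 0 < A.normal H (A.basePoint C)
    · have := h.mp hp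
      nlinarith [pos_of_mul_pos_left h1 hp.le, neg_of_mul_neg_left h2 this.le]
    · have hn := lt_of_le_of_ne (not_lt.mp hp) hC
      have hn' := lt_of_le_of_ne (not_lt.mp (fun h' => hp (h.mpr h'))) hC'
      nlinarith [neg_of_mul_pos_left h1 hn.le, pos_of_mul_neg_left h2 hn'.le]
  · intro h
    have hs : ∀ (D : A.Chamber), ¬ 0 < A.normal H (A.basePoint D) → ∀ x ∈ D.1,
        A.normal H x < 0 := by
      intro D hD x hx
      have h1 := mt (A.normal_pos_iff hH D hx).mp hD
      refine lt_of_le_of_ne (not_lt.mp h1) (A.normal_ne_zero hH ?_)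
      rw [D.eq_component] at hx
      exact connectedComponentIn_subset _ _ hx
    by_cases hp : 0 < A.normal H (A.basePoint C)
    · exact ⟨A.normal H, A.ker_normal hH, fun x hx => (A.normal_pos_iff hH C hx).mpr hp,
        hs C' (by tauto)⟩
    · refine ⟨-A.normal H, ?_, fun x hx => ?_, fun x hx => ?_⟩
      · rw [← A.ker_normal hH]; ext x; simp [A.ker_normal hH]
      · simpa using hs C hp x hx
      · simpa using (A.normal_pos_iff hH C' hx).mpr (by tauto)

theorem sep_subset (A : Arrangement d) (C C' : A.Chamber) :
    A.sep C C' ⊆ (A.hyperplanes : Set (Submodule ℝ (EuclideanSpace ℝ (Fin d)))) :=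
  fun _ h => h.1

/-- Separating sets compose by symmetric difference. -/
theorem mem_sep_trans (A : Arrangement d) (C C' C'' : A.Chamber)
    (H : Submodule ℝ (EuclideanSpace ℝ (Fin d))) :
    H ∈ A.sep C C'' ↔ Xor (H ∈ A.sep C C') (H ∈ A.sep C' C'') := by
  simp only [mem_sep_iff, Xor]
  by_cases hH : H ∈ A.hyperplanes <;> simp only [hH, true_and, false_and] <;> tauto

/-- All normals have equal strict signs at the two base points, so the segment between them stays in
the complement. -/
theorem eq_of_sep_eq_empty (A : Arrangement d) {C C' : A.Chamber} (h : A.sep C C' = ∅) :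
    C = C' := by
  have hseg : segment ℝ (A.basePoint C) (A.basePoint C') ⊆ A.complement := by
    rintro z ⟨a, b, ha, hb, hab, rfl⟩ H hH hz
    rw [← A.ker_normal hH, LinearMap.mem_ker, map_add, map_smul, map_smul] at hz
    simp only [smul_eq_mul] at hz
    have hn : H ∉ A.sep C C' := by simp [h]
    rw [mem_sep_iff] at hn
    have h1 := A.normal_ne_zero hH (A.basePoint_mem_complement C)
    have h2 := A.normal_ne_zero hH (A.basePoint_mem_complement C')
    have hiff := not_not.mp (fun h' => hn ⟨hH, h'⟩)
    by_cases hp : 0 < A.normal H (A.basePoint C)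
    · have hp' := hiff.mp hp
      rcases ha.eq_or_lt with rfl | ha
      · have : b = 1 := by linarith
        subst this
        linarith
      · nlinarith [mul_pos ha hp, mul_nonneg hb hp'.le]
    · have hq := lt_of_le_of_ne (not_lt.mp hp) h1
      have hq' := lt_of_le_of_ne (not_lt.mp (fun h' => hp (hiff.mpr h'))) h2
      rcases ha.eq_or_lt with rfl | ha
      · have : b = 1 := by linarith
        subst this
        linarith
      · nlinarith [mul_neg_of_pos_of_neg ha hq, mul_nonpos_of_nonneg_of_nonpos hb hq'.le]
  have hsub := (convex_segment _ _).isPreconnected.subset_connectedComponentIn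
    (left_mem_segment ℝ _ _) hseg
  apply Subtype.ext
  rw [C.eq_component, C'.eq_component]
  exact connectedComponentIn_eq (hsub (right_mem_segment ℝ _ _))

/-! ### Rank, independence of normals and the Boolean property -/

theorem center_eq_dualCoannihilator (A : Arrangement d) :
    A.center = (Submodule.span ℝ (Set.range fun H : A.hyperplanes => A.normal H)).dualCoannihilator := by
  ext p
  rw [Submodule.mem_dualCoannihilator, center, inter, Submodule.mem_sInf]
  constructor
  · intro h φ hφ
    induction hφ using Submodule.span_induction with
    | mem φ hφ =>
      obtain ⟨H, rfl⟩ := hφ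
      have := h H H.2
      rwa [← A.ker_normal H.2] at this
    | zero => simp
    | add φ ψ _ _ h1 h2 => simp [h1, h2]
    | smul a φ _ h1 => simp [h1]
  · intro h H hH
    rw [← A.ker_normal hH]
    exact h _ (Submodule.subset_span ⟨⟨H, hH⟩, rfl⟩)

theorem rank_eq_finrank_span (A : Arrangement d) :
    A.rank = Set.finrank ℝ (Set.range fun H : A.hyperplanes => A.normal H) := by
  have h1 := Subspace.finrank_add_finrank_dualCoannihilator_eq
    (Submodule.span ℝ (Set.range fun H : A.hyperplanes => A.normal H))
  have h2 := A.center.finrank_quotient_add_finrank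
  rw [rank, Set.finrank]
  rw [← h1] at h2
  exact Nat.add_right_cancel (h2.trans (by rw [center_eq_dualCoannihilator]))

theorem isBoolean_of_linearIndependent (A : Arrangement d)
    (h : LinearIndependent ℝ fun H : A.hyperplanes => A.normal H) : A.IsBoolean := by
  classical
  let b := Module.Basis.sumExtend h
  have : Finite (A.hyperplanes ⊕ Module.Basis.sumExtendIndex h) := Module.Finite.finite_basis b
  have := Fintype.ofFinite (A.hyperplanes ⊕ Module.Basis.sumExtendIndex h)
  -- The normals extend to a basis `b` of the dual space; `e` is the basis of ℝ^d whose coordinate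
  -- forms are `b`.
  let e := b.dualBasis.map (Module.evalEquiv ℝ (EuclideanSpace ℝ (Fin d))).symm
  have hcoord : ∀ i, e.coord i = b i := by
    intro i
    refine e.ext fun j => ?_
    have : b i (e j) = b.dualBasis j (b i) := by
      simp only [e, Module.Basis.map_apply]
      exact LinearMap.congr_fun ((Module.evalEquiv ℝ (EuclideanSpace ℝ (Fin d))).apply_symm_apply
        (b.dualBasis j)) (b i)
    rw [this, Module.Basis.dualBasis_apply_self, Module.Basis.coord_apply,
      Module.Basis.repr_self, Finsupp.single_apply]
    simp [eq_comm]
  have hcard : Fintype.card (A.hyperplanes ⊕ Module.Basis.sumExtendIndex h) =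
      Fintype.card (Fin d) := by
    rw [← Module.finrank_eq_card_basis e]
    simp
  let σ := Fintype.equivOfCardEq hcard
  refine ⟨e.reindex σ, fun H hH => ⟨σ (Sum.inl ⟨H, hH⟩), ?_⟩⟩
  have : (e.reindex σ).coord (σ (Sum.inl ⟨H, hH⟩)) = e.coord (Sum.inl ⟨H, hH⟩) := by
    ext p
    simp [Module.Basis.coord_apply]
  rw [this, hcoord]
  have hb : b (Sum.inl ⟨H, hH⟩) = A.normal H := by
    simp only [b, Module.Basis.sumExtend, Module.Basis.reindex_apply, Module.Basis.extend_apply_self]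
    rfl
  rw [hb]
  exact (A.ker_normal hH).symm

theorem rank_lt_card (A : Arrangement d) (hA : ¬ A.IsBoolean) : A.rank < A.card := by
  by_contra h
  refine hA (A.isBoolean_of_linearIndependent ?_)
  rw [linearIndependent_iff_card_le_finrank_span, ← rank_eq_finrank_span]
  simpa [card] using h

/-- If every subset of a set `B` of hyperplanes separates some chamber from a fixed chamber `C`,
and `B` has the same intersection as the arrangement, then the arrangement is Boolean. -/
theorem isBoolean_of_forall_exists_sep (A : Arrangement d) (C : A.Chamber)
    (B : Finset (Submodule ℝ (EuclideanSpace ℝ (Fin d)))) (hBA : B ⊆ A.hyperplanes)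
    (hB : inter (B : Set (Submodule ℝ (EuclideanSpace ℝ (Fin d)))) = A.center)
    (h : ∀ T ⊆ B, ∃ D : A.Chamber, A.sep C D = (T : Set _)) : A.IsBoolean := by
  classical
  -- Crossing exactly those H in B whose term `a H * A.normal H` is positive at C makes every term
  -- nonpositive at D.
  have key : ∀ a : Submodule ℝ (EuclideanSpace ℝ (Fin d)) → ℝ, ∃ D : A.Chamber,
      A.sep C D ⊆ (B : Set _) ∧ ∀ H ∈ B, a H * A.normal H (A.basePoint D) ≤ 0 ∧
        (a H ≠ 0 → a H * A.normal H (A.basePoint D) ≠ 0) := by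
    intro a
    obtain ⟨D, hD⟩ := h (B.filter fun H => 0 < a H * A.normal H (A.basePoint C))
      (Finset.filter_subset _ _)
    refine ⟨D, by rw [hD]; exact_mod_cast Finset.filter_subset _ _, fun H hH => ⟨?_, fun ha =>
      mul_ne_zero ha (A.normal_ne_zero (hBA hH) (A.basePoint_mem_complement D))⟩⟩
    have hC0 := A.normal_ne_zero (hBA hH) (A.basePoint_mem_complement C)
    have hm : H ∈ A.sep C D ↔ 0 < a H * A.normal H (A.basePoint C) := by
      rw [hD, Finset.mem_coe, Finset.mem_filter, and_iff_right hH]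
    rw [mem_sep_iff] at hm
    simp only [hBA hH, true_and] at hm
    by_contra! hpos
    rcases lt_or_gt_of_ne hC0 with hc | hc
    · rcases pos_and_pos_or_neg_and_neg_of_mul_pos hpos with ⟨h1, h2⟩ | ⟨h1, h2⟩
      · have := hm.mp (by simp [h2, hc.le])
        nlinarith
      · have := hm.mpr (mul_pos_of_neg_of_neg h1 hc)
        exact this (iff_of_false hc.not_gt h2.not_gt)
    · rcases pos_and_pos_or_neg_and_neg_of_mul_pos hpos with ⟨h1, h2⟩ | ⟨h1, h2⟩
      · have := hm.mpr (mul_pos h1 hc)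
        exact this (iff_of_true hc h2)
      · have := hm.mp (by simp [h2.le, hc])
        nlinarith
  have hAB : A.hyperplanes = B := by
    refine (Finset.Subset.antisymm ?_ hBA)
    intro H hH
    by_contra hHB
    have hmem := mem_span_of_iInf_ker_le_ker (L := fun K : B => A.normal K) (K := A.normal H) (by
      rw [A.ker_normal hH]
      refine le_trans ?_ (hB.le.trans (sInf_le (Finset.mem_coe.mpr hH)))
      refine le_sInf fun K hK => (iInf_le _ ⟨K, hK⟩).trans ?_
      exact (A.ker_normal (hBA hK)).le)
    obtain ⟨a, ha⟩ := (Submodule.mem_span_range_iff_exists_fun ℝ).mp hmem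
    -- The sign making `s * A.normal H` positive at C. It stays positive at D, as H does not
    -- separate C from D, although all its summands there are nonpositive.
    let s : ℝ := if 0 < A.normal H (A.basePoint C) then 1 else -1
    obtain ⟨D, hD, hD'⟩ := key fun K => if hK : K ∈ B then s * a ⟨K, hK⟩ else 0
    have h1 : H ∉ A.sep C D := fun h => hHB (hD h)
    rw [mem_sep_iff] at h1
    have hiff := not_not.mp (fun h' => h1 ⟨hH, h'⟩)
    have h2 : s * A.normal H (A.basePoint D) ≤ 0 := by
      rw [← ha, LinearMap.sum_apply, Finset.mul_sum]
      refine Finset.sum_nonpos fun K _ => ?_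
      have := (hD' K K.2).1
      simpa [mul_assoc] using this
    have h3 := A.normal_ne_zero hH (A.basePoint_mem_complement D)
    by_cases hp : 0 < A.normal H (A.basePoint C)
    · have := hiff.mp hp
      simp only [s, if_pos hp] at h2
      linarith
    · have := lt_of_le_of_ne (not_lt.mp (mt hiff.mpr hp)) h3
      simp only [s, if_neg hp] at h2
      linarith
  subst hAB
  refine A.isBoolean_of_linearIndependent ?_
  rw [Fintype.linearIndependent_iff]
  intro a ha K
  obtain ⟨D, -, hD⟩ := key fun K => if hK : K ∈ A.hyperplanes then a ⟨K, hK⟩ else 0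
  have h0 : ∑ K : A.hyperplanes, a K * A.normal K (A.basePoint D) = 0 := by
    have := LinearMap.congr_fun ha (A.basePoint D)
    simpa [LinearMap.sum_apply] using this
  -- A vanishing sum of nonpositive terms has all terms zero, and a term is nonzero wherever its
  -- coefficient is.
  rw [Finset.sum_eq_zero_iff_of_nonpos] at h0
  · by_contra hK
    have := (hD K K.2).2
    simp only [Finset.coe_mem, dite_true, Subtype.coe_eta] at this
    exact this hK (h0 K (Finset.mem_univ _))
  · intro K _
    have := (hD K K.2).1
    simpa using this
-- Words of walks and their permutations
open GraphMagnitude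

theorem topeGraph_edist_eq_two (A : Arrangement d) {C C' C'' : A.Chamber}
    {H K : Submodule ℝ (EuclideanSpace ℝ (Fin d))} (hHK : H ≠ K) (h1 : A.sep C C' = {H})
    (h2 : A.sep C' C'' = {K}) : A.topeGraph.edist C C'' = 2 := by
  have hmem : ∀ L, L ∈ A.sep C C'' ↔ L = H ∨ L = K := by
    intro L
    rw [A.mem_sep_trans C C' C'', h1, h2, Set.mem_singleton_iff, Set.mem_singleton_iff, Xor]
    constructor
    · tauto
    · rintro (rfl | rfl)
      · exact Or.inl ⟨rfl, hHK⟩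
      · exact Or.inr ⟨rfl, hHK.symm⟩
  have e1 : A.topeGraph.edist C C' = 1 := SimpleGraph.edist_eq_one_iff_adj.mpr ⟨H, h1⟩
  have e2 : A.topeGraph.edist C' C'' = 1 := SimpleGraph.edist_eq_one_iff_adj.mpr ⟨K, h2⟩
  have hle : A.topeGraph.edist C C'' ≤ 2 := by
    have := SimpleGraph.edist_triangle (G := A.topeGraph) (u := C) (v := C') (w := C'')
    rwa [e1, e2, one_add_one_eq_two] at this
  have h0 : A.topeGraph.edist C C'' ≠ 0 := by
    rw [Ne, SimpleGraph.edist_eq_zero_iff]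
    rintro rfl
    have := (hmem H).mpr (Or.inl rfl)
    rw [A.sep_self] at this
    exact this
  have hone : A.topeGraph.edist C C'' ≠ 1 := by
    rw [Ne, SimpleGraph.edist_eq_one_iff_adj]
    rintro ⟨L, hL⟩
    have hH := (hmem H).mpr (Or.inl rfl)
    have hK := (hmem K).mpr (Or.inr rfl)
    rw [hL] at hH hK
    exact hHK (hH.trans hK.symm)
  refine le_antisymm hle ?_
  have h3 := Order.add_one_le_of_lt
    (lt_of_le_of_ne (Order.one_le_iff_ne_zero.mpr h0) (Ne.symm hone))
  rwa [one_add_one_eq_two] at h3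

/-- A second midpoint of a pair of chambers at distance two crosses the two hyperplanes in the
opposite order. -/
theorem sep_eq_of_ne (A : Arrangement d) {C M M' D : A.Chamber}
    {H K : Submodule ℝ (EuclideanSpace ℝ (Fin d))} (hHK : H ≠ K) (h1 : A.sep C M = {H})
    (h2 : A.sep M D = {K}) (hne : M' ≠ M) (h1' : A.topeGraph.Adj C M')
    (h2' : A.topeGraph.Adj M' D) : A.sep C M' = {K} ∧ A.sep M' D = {H} := by
  obtain ⟨H', e1⟩ := h1'
  obtain ⟨K', e2⟩ := h2'
  have h (L) : Xor (L = H) (L = K) ↔ Xor (L = H') (L = K') := by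
    have a1 := A.mem_sep_trans C M D L
    have a2 := A.mem_sep_trans C M' D L
    rw [h1, h2] at a1
    rw [e1, e2] at a2
    exact a1.symm.trans a2
  -- With the same first letter, no hyperplane would separate the two midpoints.
  have hH : H' ≠ H := by
    rintro rfl
    refine hne (A.eq_of_sep_eq_empty ?_)
    ext L
    rw [A.mem_sep_trans M' C M, A.sep_comm M' C, e1, h1]
    simp [Xor]
  have hH' : H = K' := by
    have := (h H).mp (Or.inl ⟨rfl, hHK⟩)
    rcases this with ⟨h, -⟩ | ⟨h, -⟩
    · exact absurd h.symm hH
    · exact h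
  have hK' : K = H' := by
    have := (h K).mp (Or.inr ⟨rfl, hHK.symm⟩)
    rcases this with ⟨h, -⟩ | ⟨h, -⟩
    · exact h
    · exact absurd (hH'.trans h.symm) hHK
  rw [e1, e2, hK', hH']
  exact ⟨rfl, rfl⟩

/-- The chain `x` is the walk from `C` which crosses the hyperplanes of the list `w` in order. -/
def HasWord (A : Arrangement d) (C : A.Chamber) {k : ℕ} (x : Fin (k + 1) → A.Chamber)
    (w : List (Submodule ℝ (EuclideanSpace ℝ (Fin d)))) : Prop :=
  w.length = k ∧ x 0 = C ∧
    ∀ (i : Fin k) (h : (i : ℕ) < w.length), A.sep (x i.castSucc) (x i.succ) = {w[i]}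

theorem exists_hasWord (A : Arrangement d) {l : ℕ} (x : ProperChain A.topeGraph l l) :
    ∃ w, A.HasWord (x.1 0) x.1 w := by
  choose H hH using fun i => x.adj_of_degree_eq_length i
  refine ⟨List.ofFn H, by simp, rfl, fun i h => ?_⟩
  rw [hH i]
  simp

theorem HasWord.crossed_eq {A : Arrangement d} {C : A.Chamber} {k : ℕ}
    {x : Fin (k + 1) → A.Chamber} {w : List (Submodule ℝ (EuclideanSpace ℝ (Fin d)))}
    (h : A.HasWord C x w) : A.crossed x = {H | H ∈ w} := by
  obtain ⟨rfl, -, h⟩ := h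
  ext H
  simp only [crossed, Set.mem_iUnion, Set.mem_ofPred_eq, List.mem_iff_getElem]
  constructor
  · rintro ⟨i, hi⟩
    rw [h i i.2] at hi
    exact ⟨i, i.2, hi.symm⟩
  · rintro ⟨i, hi, rfl⟩
    refine ⟨⟨i, hi⟩, ?_⟩
    rw [h ⟨i, hi⟩ hi]
    rfl

/-- Separating sets add by symmetric difference; since no letter of the prefix repeats, this is a
union. -/
theorem HasWord.sep_take {A : Arrangement d} {C : A.Chamber} {k : ℕ}
    {x : Fin (k + 1) → A.Chamber} {u v : List (Submodule ℝ (EuclideanSpace ℝ (Fin d)))}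
    (h : A.HasWord C x (u ++ v)) (hu : u.Nodup) : ∃ D, A.sep C D = {H | H ∈ u} := by
  obtain ⟨hk, h0, h⟩ := h
  have hlen : u.length ≤ k := by rw [← hk]; simp
  suffices ∀ m (hm : m ≤ u.length),
      A.sep C (x ⟨m, by omega⟩) = {H | H ∈ u.take m} by
    exact ⟨_, (this u.length le_rfl).trans (by simp)⟩
  intro m
  induction m with
  | zero =>
    intro _
    have : A.sep C (x 0) = ∅ := by rw [h0, A.sep_self]
    simpa using this
  | succ m ih =>
    intro hm
    have ih := ih (by omega)
    have hs := h ⟨m, by omega⟩ (by simp; omega)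
    have hget : (u ++ v)[m]'(by simp; omega) = u[m] := List.getElem_append_left (by omega)
    have hnot : u[m] ∉ u.take m := by
      intro hmem
      obtain ⟨j, hj, he⟩ := List.mem_take_iff_getElem.mp hmem
      have := (hu.getElem_inj_iff).mp he
      omega
    ext H
    rw [A.mem_sep_trans C (x ⟨m, by omega⟩), ih, List.take_add_one]
    have hs' : A.sep (x ⟨m, by omega⟩) (x ⟨m + 1, by omega⟩) = {u[m]} := by
      rw [← hget]; exact hs
    rw [hs']
    simp only [Xor, Set.mem_ofPred_eq, Set.mem_singleton_iff, List.mem_append,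
      List.getElem?_eq_getElem (show m < u.length by omega), Option.toList_some,
      List.mem_singleton]
    constructor
    · tauto
    · rintro (h | rfl)
      · refine Or.inl ⟨h, ?_⟩
        rintro rfl
        exact hnot h
      · exact Or.inr ⟨rfl, hnot⟩

/-- Swapping two adjacent letters in the word of a walk which occurs in a cycle. -/
theorem HasWord.exists_swap {A : Arrangement d} {C : A.Chamber} {l : ℕ}
    {c : MC A.topeGraph l l} (hc : c ∈ cycles A.topeGraph l l)
    {u v : List (Submodule ℝ (EuclideanSpace ℝ (Fin d)))}
    {H K : Submodule ℝ (EuclideanSpace ℝ (Fin d))} {x : ProperChain A.topeGraph l l}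
    (hx : c x ≠ 0) (h : A.HasWord C x.1 (u ++ H :: K :: v)) :
    ∃ y : ProperChain A.topeGraph l l, c y ≠ 0 ∧ A.HasWord C y.1 (u ++ K :: H :: v) := by
  -- For equal letters the swap changes nothing; smoothness of the midpoint needs H ≠ K.
  by_cases hHK : H = K
  · subst hHK
    exact ⟨x, hx, h⟩
  obtain ⟨hlen, h0, h⟩ := h
  simp only [List.length_append, List.length_cons] at hlen
  obtain ⟨n, rfl⟩ : ∃ n, l = n + 1 := ⟨u.length + v.length + 1, by omega⟩
  let i : Fin n := ⟨u.length, by omega⟩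
  have hi : (i : ℕ) = u.length := rfl
  have s1 : A.sep (x.1 i.castSucc.castSucc) (x.1 i.succ.castSucc) = {H} := by
    have := h i.castSucc (by simp [hi])
    simpa [hi] using this
  have s2 : A.sep (x.1 i.succ.castSucc) (x.1 i.succ.succ) = {K} := by
    have := h i.succ (by simp [hi])
    simpa [hi] using this
  have hsm : IsSmooth A.topeGraph x.1 i := by
    rw [IsSmooth, A.topeGraph_edist_eq_two hHK s1 s2,
      SimpleGraph.edist_eq_one_iff_adj.mpr (show A.topeGraph.Adj _ _ from ⟨H, s1⟩),
      SimpleGraph.edist_eq_one_iff_adj.mpr (show A.topeGraph.Adj _ _ from ⟨K, s2⟩),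
      one_add_one_eq_two]
  obtain ⟨y, hyx, hcy, hy⟩ := exists_ne_of_mem_ker_boundary (LinearMap.mem_ker.mp hc) hx hsm
  have hmid : y.1 i.succ.castSucc ≠ x.1 i.succ.castSucc := by
    intro e
    refine hyx (Subtype.ext (funext fun m => ?_))
    by_cases hm : m = i.succ.castSucc
    · rw [hm, e]
    · exact hy m hm
  have y1 : y.1 i.castSucc.castSucc = x.1 i.castSucc.castSucc :=
    hy _ (by simp [Fin.ext_iff])
  have y2 : y.1 i.succ.succ = x.1 i.succ.succ := hy _ (by simp [Fin.ext_iff])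
  have a1 := y.adj_of_degree_eq_length i.castSucc
  have a2 := y.adj_of_degree_eq_length i.succ
  rw [← Fin.castSucc_succ, y1] at a1
  rw [y2] at a2
  obtain ⟨t1, t2⟩ := A.sep_eq_of_ne hHK s1 s2 hmid a1 a2
  refine ⟨y, hcy, by simpa using hlen, ?_, fun j hj => ?_⟩
  · rw [hy 0 (by simp [Fin.ext_iff]), h0]
  · by_cases j1 : (j : ℕ) = u.length
    · obtain rfl : j = i.castSucc := Fin.ext j1
      rw [← Fin.castSucc_succ, y1, t1]
      simp [hi]
    · by_cases j2 : (j : ℕ) = u.length + 1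
      · obtain rfl : j = i.succ := Fin.ext j2
        rw [y2, t2]
        simp [hi]
      · rw [hy j.castSucc (by simp [Fin.ext_iff]; omega), hy j.succ (by simp [Fin.ext_iff]; omega),
          h j (by simpa using hj)]
        congr 1
        simp only [Fin.getElem_fin]
        rcases lt_or_gt_of_ne j1 with hlt | hgt
        · rw [List.getElem_append_left hlt, List.getElem_append_left hlt]
        · rw [List.getElem_append_right hgt.le, List.getElem_append_right hgt.le]
          obtain ⟨m, hm⟩ : ∃ m, (j : ℕ) - u.length = m + 2 := ⟨j - u.length - 2, by omega⟩
          simp [hm]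

/-! ### Vanishing of diagonal interior cycles -/

theorem inter_crossed_of_mem_interiorMC (A : Arrangement d) {k l : ℕ} {c : MC A.topeGraph k l}
    (hc : c ∈ A.interiorMC k l) {x : ProperChain A.topeGraph k l} (hx : c x ≠ 0) :
    inter (A.crossed x.1) = A.center := by
  have hle : A.interiorMC k l ≤
      Finsupp.supported ℤ ℤ {x : ProperChain A.topeGraph k l | inter (A.crossed x.1) = A.center} := by
    refine iSup₂_le fun B hB => Submodule.span_le.mpr ?_
    rintro _ ⟨y, hy, rfl⟩
    refine Finsupp.single_mem_supported ℤ _ ?_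
    rw [Set.mem_ofPred_eq, hy]
    exact hB.2
  exact hle hc (Finsupp.mem_support_iff.mpr hx)

/-- A non-Boolean arrangement has no interior diagonal cycles. -/
theorem interiorMC_inf_cycles_eq_bot (A : Arrangement d) (hA : ¬ A.IsBoolean) (l : ℕ) :
    A.interiorMC l l ⊓ cycles A.topeGraph l l = ⊥ := by
  classical
  rw [Submodule.eq_bot_iff]
  rintro c ⟨hint, hc⟩
  by_contra hne
  obtain ⟨x, hx⟩ := Finsupp.ne_iff.mp hne
  simp only [Finsupp.coe_zero, Pi.zero_apply] at hx
  obtain ⟨w, hw⟩ := A.exists_hasWord x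
  have hB : ((w.toFinset : Finset _) : Set (Submodule ℝ (EuclideanSpace ℝ (Fin d)))) =
      A.crossed x.1 := by
    rw [hw.crossed_eq]; ext; simp
  refine hA (A.isBoolean_of_forall_exists_sep (x.1 0) w.toFinset ?_ ?_ fun T hT => ?_)
  · rw [← Finset.coe_subset, hB]
    exact Set.iUnion_subset fun i => A.sep_subset _ _
  · rw [hB]
    exact A.inter_crossed_of_mem_interiorMC hint hx
  -- Permute the word so that T comes first, each element once; repeated letters of `w` go into the
  -- remainder `v`.
  · have hsub : T.toList ⊆ w := fun H hH => by
      simpa using hT (Finset.mem_toList.mp hH)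
    obtain ⟨u, hu, hsl⟩ := List.subperm_of_subset T.nodup_toList hsub
    obtain ⟨v, hv⟩ := hsl.exists_perm_append
    have hperm : w.Perm (T.toList ++ v) := hv.trans (hu.append_right v)
    obtain ⟨y, -, hy⟩ := List.Perm.of_adjacent_swap
      (W := fun w => ∃ y : ProperChain A.topeGraph l l, c y ≠ 0 ∧ A.HasWord (x.1 0) y.1 w)
      (fun _ _ _ _ ⟨_, hz, hz'⟩ => hz'.exists_swap hc hz) hperm [] ⟨x, hx, hw⟩
    obtain ⟨D, hD⟩ := HasWord.sep_take (u := T.toList) hy T.nodup_toList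
    exact ⟨D, by rw [hD]; ext; simp⟩

end Arrangement
end

theorem theorem5 {d : ℕ} (A : Arrangement d) (hA : ¬ A.IsBoolean) :
    A.rank < A.card ∧ ∀ ℓ : ℕ, Subsingleton (A.interiorMH ℓ ℓ) := by
  refine ⟨A.rank_lt_card hA, fun l => ?_⟩
  have h := A.interiorMC_inf_cycles_eq_bot hA l
  have : Subsingleton ↥(A.interiorMC l l ⊓ GraphMagnitude.cycles A.topeGraph l l) := by
    rw [h]; infer_instance
  exact (Submodule.mkQ_surjective _).subsingleton
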